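/- Let $A\in\mathbb C^{n\times n}$ be Hermitian, let $\mathcal X,\mathcal Y\subseteq\mathbb C^n$ be subspaces of the same dimension $p$, and let $X,Y\in\mathbb C^{n\times p}$ have columns that form orthonormal bases of $\mathcal X$ and $\mathcal Y$, respectively. Notation. $\Lambda(M)$ is the vector of eigenvalues of a Hermitian matrix $M$ and $S(M)$ the vector of singular values of a matrix $M$, both in decreasing order and with multiplicity (for an $n\times p$ matrix with $p\le n$, $S(M)=[s_1(M),\dots,s_p(M)]$). $P_{\mathcal X}$ and $P_{\mathcal Y}$ are the orthogonal projectors onto $\mathcal X$ and $\mathcal Y$. The residual matrices are $R_X=AX-X(X^HAX)$ and $R_Y=AY-Y(Y^HAY)$. The principal angles between $\mathcal X$ and $\mathcal Y$ are the numbers in $[0,\pi/2]$ whose cosines are the singular values of $X^HY$; $\Theta^\downarrow(\mathcal X,\mathcal Y)$ is the vector of these $p$ angles in decreasing order, and $\theta_{\max}$ and $\theta_{\min}$ are the largest and the smallest of them. Absolute values, cosines and arithmetic operations on vectors are taken entry-wise. For $x,y\in\mathbb R^p$, $x\prec_w y$ means that $\sum_{i=1}^k x_i^\downarrow\le\sum_{i=1}^k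 y_i^\downarrow$ for $k=1,\dots,p$, where $x^\downarrow$ is $x$ rearranged in decreasing order. Assume that all principal angles between $\mathcal X$ and $\mathcal Y$ are less than $\pi/2$, and put $c=\cos\theta_{\min}/\cos\theta_{\max}$. Then $$\left|\Lambda(X^HAX)-\Lambda(Y^HAY)\right|\prec_w\sqrt c\,\frac{S(P_{\mathcal Y}R_X)+S(P_{\mathcal X}R_Y)}{\cos\Theta^\downarrow(\mathcal X,\mathcal Y)}.$$ If, in addition, $\mathcal X$ is $A$-invariant, that is, $A\mathcal X\subseteq\mathcal X$, then $$\left|\Lambda(X^HAX)-\Lambda(Y^HAY)\right|\prec_w\sqrt c\,\frac{S(P_{\mathcal X}R_Y)}{\cos\Theta^\downarrow(\mathcal X,\mathcal Y)}.$$ -/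

import Mathlib

noncomputable section

namespace RayleighRitz

/-- The rearrangement `x↓` of the coordinates of `x` in decreasing order. -/
def decreasing {p : ℕ} (x : Fin p → ℝ) : Fin p → ℝ := fun i => x (Tuple.sort x i.rev)

/-- Weak majorization `x ≺_w y`: every partial sum of the decreasing rearrangement of `x` is at most
the corresponding partial sum for `y`. -/
def WeaklyMajorized {p : ℕ} (x y : Fin p → ℝ) : Prop :=
  ∀ k : Fin p, ∑ i ∈ Finset.Iic k, decreasing x i ≤ ∑ i ∈ Finset.Iic k, decreasing y i

infix:50 " ≺w " => WeaklyMajorized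

/-- The vector `Λ(M)` of the eigenvalues of a Hermitian matrix `M`, with multiplicity, in
decreasing order. -/
def eigenvalueVector {p : ℕ} {M : Matrix (Fin p) (Fin p) ℂ} (hM : M.IsHermitian) : Fin p → ℝ :=
  fun i => hM.eigenvalues₀ (i.cast (Fintype.card_fin p).symm)

/-- The vector `S(M)` of the singular values of an `n × p` matrix `M`, in decreasing order
(zero-indexed, one entry for each column of `M`). -/
def singularValueVector {n p : ℕ} (M : Matrix (Fin n) (Fin p) ℂ) : Fin p → ℝ :=
  fun i => (Matrix.toEuclideanLin M).singularValues i

/-- The columns of `X` form an orthonormal basis of the subspace `𝒳` of `ℂⁿ`. -/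
structure IsOrthonormalBasisMatrix {n p : ℕ} (X : Matrix (Fin n) (Fin p) ℂ)
    (𝒳 : Submodule ℂ (EuclideanSpace ℂ (Fin n))) : Prop where
  orthonormal : Orthonormal ℂ (fun j => (WithLp.toLp 2 (X.col j) : EuclideanSpace ℂ (Fin n)))
  span_eq : Submodule.span ℂ
    (Set.range fun j => (WithLp.toLp 2 (X.col j) : EuclideanSpace ℂ (Fin n))) = 𝒳

/-- The matrix `P_𝒳` of the orthogonal projector of `ℂⁿ` onto `𝒳`. -/
def projectorMatrix {n : ℕ} (𝒳 : Submodule ℂ (EuclideanSpace ℂ (Fin n))) :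
    Matrix (Fin n) (Fin n) ℂ :=
  Matrix.toEuclideanLin.symm (𝒳.starProjection : _ →ₗ[ℂ] _)

/-- The residual matrix `R_X = A X - X (Xᴴ A X)`. -/
def residualMatrix {n p : ℕ} (A : Matrix (Fin n) (Fin n) ℂ) (X : Matrix (Fin n) (Fin p) ℂ) :
    Matrix (Fin n) (Fin p) ℂ :=
  A * X - X * (X.conjTranspose * A * X)

/-- The orthogonal projection onto `𝒳` restricted to `𝒴`. If the columns of `X` and `Y` form
orthonormal bases of `𝒳` and `𝒴`, its matrix in these bases is `Xᴴ Y`. -/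
def compression {n : ℕ} (𝒳 𝒴 : Submodule ℂ (EuclideanSpace ℂ (Fin n))) : 𝒴 →ₗ[ℂ] 𝒳 :=
  (𝒳.orthogonalProjectionOnto : EuclideanSpace ℂ (Fin n) →ₗ[ℂ] 𝒳) ∘ₗ 𝒴.subtype

/-- The number `min (dim 𝒳) (dim 𝒴)` of principal angles between `𝒳` and `𝒴`. -/
def numAngles {n : ℕ} (𝒳 𝒴 : Submodule ℂ (EuclideanSpace ℂ (Fin n))) : ℕ :=
  min (Module.finrank ℂ 𝒳) (Module.finrank ℂ 𝒴)

/-- The principal angles between `𝒳` and `𝒴` in decreasing order, indexed by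
`0 ≤ i < numAngles 𝒳 𝒴`: the cosines of the angles are the singular values of `Xᴴ Y`, and the
largest angle comes from the smallest singular value. -/
def principalAngle {n : ℕ} (𝒳 𝒴 : Submodule ℂ (EuclideanSpace ℂ (Fin n))) (i : ℕ) : ℝ :=
  Real.arccos (LinearMap.singularValues (𝕜 := ℂ) (E := 𝒴) (F := 𝒳) (compression 𝒳 𝒴)
    (numAngles 𝒳 𝒴 - 1 - i))

/-- The largest principal angle. -/
def maxAngle {n : ℕ} (𝒳 𝒴 : Submodule ℂ (EuclideanSpace ℂ (Fin n))) : ℝ :=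
  principalAngle 𝒳 𝒴 0

/-- The smallest principal angle. -/
def minAngle {n : ℕ} (𝒳 𝒴 : Submodule ℂ (EuclideanSpace ℂ (Fin n))) : ℝ :=
  principalAngle 𝒳 𝒴 (numAngles 𝒳 𝒴 - 1)

theorem singularValues_comp_isometry {E F E' F' : Type*}
    [NormedAddCommGroup E] [InnerProductSpace ℂ E] [FiniteDimensional ℂ E]
    [NormedAddCommGroup F] [InnerProductSpace ℂ F] [FiniteDimensional ℂ F]
    [NormedAddCommGroup E'] [InnerProductSpace ℂ E'] [FiniteDimensional ℂ E']
    [NormedAddCommGroup F'] [InnerProductSpace ℂ F'] [FiniteDimensional ℂ F']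
    (T : E →ₗ[ℂ] F) (T' : E' →ₗ[ℂ] F') (e : E ≃ₗᵢ[ℂ] E') (f : F ≃ₗᵢ[ℂ] F')
    (h : ∀ x, T' (e x) = f (T x)) : T'.singularValues = T.singularValues := by
  have key : LinearMap.adjoint T' ∘ₗ T' =
      e.toLinearEquiv.conj (LinearMap.adjoint T ∘ₗ T) := by
    ext x
    refine ext_inner_right ℂ fun y => ?_
    obtain ⟨x, rfl⟩ := e.surjective x
    obtain ⟨y, rfl⟩ := e.surjective y
    simp [LinearEquiv.conj_apply, LinearMap.adjoint_inner_left, h]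
  have hdim : Module.finrank ℂ E' = Module.finrank ℂ E := e.toLinearEquiv.finrank_eq.symm
  ext i
  by_cases hi : i < Module.finrank ℂ E
  · rw [T.singularValues_of_lt rfl hi, T'.singularValues_of_lt hdim hi]
    have := (LinearMap.IsSymmetric.eigenvalues_eq_eigenvalues_iff
      T'.isSymmetric_adjoint_comp_self hdim T.isSymmetric_adjoint_comp_self rfl).2
        (by rw [key, LinearEquiv.charpoly_conj])
    rw [this]
  · rw [T.singularValues_of_finrank_le (not_lt.mp hi),
      T'.singularValues_of_finrank_le (hdim ▸ not_lt.mp hi)]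

theorem IsOrthonormalBasisMatrix.finrank_eq {n p : ℕ} {X : Matrix (Fin n) (Fin p) ℂ}
    {𝒳 : Submodule ℂ (EuclideanSpace ℂ (Fin n))} (hX : IsOrthonormalBasisMatrix X 𝒳) :
    Module.finrank ℂ 𝒳 = p := by
  rw [← hX.span_eq, finrank_span_eq_card hX.orthonormal.linearIndependent, Fintype.card_fin]

/-- An orthonormal basis of `𝒳` with the columns of `X` as its vectors. -/
theorem IsOrthonormalBasisMatrix.exists_basis {n p : ℕ} {X : Matrix (Fin n) (Fin p) ℂ}
    {𝒳 : Submodule ℂ (EuclideanSpace ℂ (Fin n))} (hX : IsOrthonormalBasisMatrix X 𝒳) :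
    ∃ b : OrthonormalBasis (Fin p) ℂ 𝒳,
      ∀ j, (b j : EuclideanSpace ℂ (Fin n)) = WithLp.toLp 2 (X.col j) := by
  have hmem : ∀ j, (WithLp.toLp 2 (X.col j) : EuclideanSpace ℂ (Fin n)) ∈ 𝒳 := fun j => by
    rw [← hX.span_eq]; exact Submodule.subset_span ⟨j, rfl⟩
  have hon : Orthonormal ℂ (fun j => (⟨_, hmem j⟩ : 𝒳)) := by
    have := hX.orthonormal
    rw [orthonormal_iff_ite] at this ⊢
    intro i j
    simpa using this i j
  have hsp : ⊤ ≤ Submodule.span ℂ (Set.range fun j => (⟨_, hmem j⟩ : 𝒳)) := by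
    rw [top_le_iff]
    apply hon.linearIndependent.span_eq_top_of_card_eq_finrank'
    rw [hX.finrank_eq, Fintype.card_fin]
  exact ⟨OrthonormalBasis.mk hon hsp, fun j => by simp⟩

/-- The singular values that define the principal angles are those of `Xᴴ Y`, for every choice of
orthonormal bases `X` and `Y` of `𝒳` and `𝒴`. -/
theorem singularValues_compression {n p q : ℕ} {X : Matrix (Fin n) (Fin p) ℂ}
    {Y : Matrix (Fin n) (Fin q) ℂ} {𝒳 𝒴 : Submodule ℂ (EuclideanSpace ℂ (Fin n))}
    (hX : IsOrthonormalBasisMatrix X 𝒳) (hY : IsOrthonormalBasisMatrix Y 𝒴) :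
    LinearMap.singularValues (𝕜 := ℂ) (E := 𝒴) (F := 𝒳) (compression 𝒳 𝒴) =
      (Matrix.toEuclideanLin (X.conjTranspose * Y)).singularValues := by
  obtain ⟨b, hb⟩ := hX.exists_basis
  obtain ⟨c, hc⟩ := hY.exists_basis
  symm
  refine singularValues_comp_isometry _ _ c.repr b.repr fun x => ?_
  have hlin : (Matrix.toEuclideanLin (X.conjTranspose * Y)) ∘ₗ c.repr.toLinearEquiv.toLinearMap =
      b.repr.toLinearEquiv.toLinearMap ∘ₗ compression 𝒳 𝒴 := by
    refine c.toBasis.ext fun j => ?_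
    ext i
    have h1 : b.repr (compression 𝒳 𝒴 (c j)) i =
        inner ℂ (WithLp.toLp 2 (X.col i) : EuclideanSpace ℂ (Fin n))
          (WithLp.toLp 2 (Y.col j)) := by
      rw [b.repr_apply_apply, ← hb, ← hc, compression]
      have h2 := 𝒳.inner_starProjection_left_eq_right (b i : EuclideanSpace ℂ (Fin n)) (c j)
      rw [Submodule.starProjection_eq_self_iff.2 (b i).2] at h2
      simp [h2]
    simp only [LinearMap.comp_apply, OrthonormalBasis.coe_toBasis]
    refine Eq.trans ?_ h1.symm
    simp [Matrix.toLpLin_apply, PiLp.inner_apply, Matrix.mulVec, dotProduct, mul_comm]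
  exact LinearMap.congr_fun hlin x

theorem norm_compression_le {n : ℕ} (𝒳 𝒴 : Submodule ℂ (EuclideanSpace ℂ (Fin n))) (v : 𝒴) :
    ‖compression 𝒳 𝒴 v‖ ≤ ‖v‖ :=
  𝒳.norm_orthogonalProjectionOnto_apply_le v

theorem singularValues_le_one_of_contraction {E F : Type*}
    [NormedAddCommGroup E] [InnerProductSpace ℂ E] [FiniteDimensional ℂ E]
    [NormedAddCommGroup F] [InnerProductSpace ℂ F] [FiniteDimensional ℂ F]
    (T : E →ₗ[ℂ] F) (h : ∀ v, ‖T v‖ ≤ ‖v‖) (i : ℕ) : T.singularValues i ≤ 1 := by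
  by_cases hi : i < Module.finrank ℂ E
  · obtain ⟨v, hv⟩ := (T.hasEigenvalue_adjoint_comp_self_sq_singularValues hi).exists_hasEigenvector
    have h0 : 0 < ‖v‖ := norm_pos_iff.2 hv.2
    have h1 : LinearMap.adjoint T (T v) = ((T.singularValues i : ℂ) ^ 2) • v := by
      simpa using hv.apply_eq_smul
    have h2 : ‖T v‖ ^ 2 = T.singularValues i ^ 2 * ‖v‖ ^ 2 := by
      have h3 := T.adjoint_inner_right v (T v)
      rw [h1, inner_smul_right, inner_self_eq_norm_sq_to_K, inner_self_eq_norm_sq_to_K] at h3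
      apply Complex.ofReal_injective
      simpa using h3.symm
    have h4 : ‖T v‖ ^ 2 ≤ ‖v‖ ^ 2 := by
      gcongr
      exact h v
    have h5 : T.singularValues i ^ 2 ≤ 1 := by
      have : 0 < ‖v‖ ^ 2 := by positivity
      nlinarith
    nlinarith [T.singularValues_nonneg i]
  · rw [T.singularValues_of_finrank_le (not_lt.1 hi)]
    exact zero_le_one

/-- The cosines of the principal angles, in increasing order of the cosines, are the singular
values of `Xᴴ Y`, for every choice of orthonormal bases `X` and `Y` of `𝒳` and `𝒴`. -/
theorem cos_principalAngle {n p : ℕ} {X Y : Matrix (Fin n) (Fin p) ℂ}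
    {𝒳 𝒴 : Submodule ℂ (EuclideanSpace ℂ (Fin n))}
    (hX : IsOrthonormalBasisMatrix X 𝒳) (hY : IsOrthonormalBasisMatrix Y 𝒴) (i : Fin p) :
    Real.cos (principalAngle 𝒳 𝒴 i) = singularValueVector (X.conjTranspose * Y) i.rev := by
  have hidx : numAngles 𝒳 𝒴 - 1 - i = (i.rev : ℕ) := by
    rw [numAngles, hX.finrank_eq, hY.finrank_eq, Fin.val_rev]
    omega
  have h0 := LinearMap.singularValues_nonneg (𝕜 := ℂ) (E := 𝒴) (F := 𝒳) (compression 𝒳 𝒴)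
    (i.rev : ℕ)
  rw [principalAngle, hidx, Real.cos_arccos (by linarith)
      (singularValues_le_one_of_contraction _ (norm_compression_le 𝒳 𝒴) _),
    singularValues_compression hX hY]
  rfl

theorem decreasing_antitone {p : ℕ} (x : Fin p → ℝ) : Antitone (decreasing x) :=
  fun _ _ h => Tuple.monotone_sort x (Fin.rev_le_rev.2 h)

end RayleighRitz

end

open RayleighRitz

/-!
The bound holds even without the factor `√c`, and `c ≥ 1`.

Put `M = Xᴴ A X`, `N = Yᴴ A Y` and `C = Xᴴ Y`. Then `M C - C N = Xᴴ R_Y - (Yᴴ R_X)ᴴ`, the matrices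
`Xᴴ R_Y`, `Yᴴ R_X` have the singular values of `P_𝒳 R_Y`, `P_𝒴 R_X`, and the singular values of `C`
are the cosines of the principal angles, hence positive. So the problem is to bound the eigenvalue
differences of `M` and `N` by the Sylvester residual `B = M C - C N`
(`sum_abs_sub_eigenvalues_le_of_sylvester`).

The polar decomposition `C = T Ω`, with `T > 0` and `Ω` unitary, allows replacing `N` by the
unitarily equivalent `N' = Ω N Ω⁻¹` and `B` by `B' = B Ω⁻¹ = M T - T N'`. The Lidskii–Mirsky
inequality (`sum_abs_sub_eigenvalues_le`) reduces the claim to the `k` largest absolute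
eigenvalues `|η j|` of `H = M - N'`. The operator `T^{-1/2} H T^{1/2}` has the eigenvalues `η j`
too; Gram–Schmidt orthonormalization `q` of its eigenvectors puts them on the diagonal of its
matrix. For Hermitian `N'` the quadratic form of this operator has the same real part as that of
`T^{-1/2} M T^{1/2} - T^{1/2} N' T^{-1/2} = T^{-1/2} B' T^{-1/2}`. Therefore
`η j = Re ⟪T^{-1/2} q j, B' T^{-1/2} q j⟫` (`exists_orthonormal_re_inner_eq`).

Finally, expanding each of the two parts of `B'` in singular vectors and using Abel summation with
Ky Fan's inequality for the weights `T⁻¹` bounds the sum of the `k` values by the sum of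
`s_i / cos θ_i` over the `k` largest singular values `s_i` and angles `θ_i`
(`sum_abs_re_inner_le`).

If `𝒳` is `A`-invariant, `R_X = 0` and the second bound is a case of the first.
-/

namespace RayleighRitz

open Finset

/-! ### Weighted sums over initial segments -/

/-- Abel summation: domination of the partial sums of `b` by those of `d` passes to weighted sums
with nonnegative decreasing weights. -/
theorem sum_mul_le_sum_mul_of_partial_sums {p : ℕ} {s b d : Fin p → ℝ} (hs : Antitone s)
    (hs0 : ∀ i, 0 ≤ s i) (h : ∀ l, ∑ i ∈ Iic l, b i ≤ ∑ i ∈ Iic l, d i) :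
    ∑ i, s i * b i ≤ ∑ i, s i * d i := by
  -- `c` is the difference; the induction keeps the last weight as a lower bound.
  suffices H : ∀ c : Fin p → ℝ, (∀ l, 0 ≤ ∑ i ∈ Iic l, c i) → 0 ≤ ∑ i, s i * c i by
    have := H (fun i => d i - b i) fun l => by
      rw [sum_sub_distrib]; linarith [h l]
    simp only [mul_sub, sum_sub_distrib] at this
    linarith
  intro c hc
  have key : ∀ m (hm : m < p),
      s ⟨m, hm⟩ * ∑ i ∈ Iic (⟨m, hm⟩ : Fin p), c i ≤ ∑ i ∈ Iic (⟨m, hm⟩ : Fin p), s i * c i := by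
    intro m
    induction m with
    | zero =>
      intro hm
      have : Iic (⟨0, hm⟩ : Fin p) = {⟨0, hm⟩} := by
        ext i; simp [Fin.le_def, Fin.ext_iff]
      simp [this]
    | succ m ih =>
      intro hm
      have hm' : m < p := by omega
      have hI : Iic (⟨m + 1, hm⟩ : Fin p) = insert ⟨m + 1, hm⟩ (Iic ⟨m, hm'⟩) := by
        ext i; simp only [mem_Iic, mem_insert, Fin.le_def, Fin.ext_iff]; omega
      have hn : (⟨m + 1, hm⟩ : Fin p) ∉ Iic (⟨m, hm'⟩ : Fin p) := by simp
      rw [hI, sum_insert hn, sum_insert hn]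
      have h1 := ih hm'
      have h2 : s ⟨m + 1, hm⟩ ≤ s ⟨m, hm'⟩ := hs (by simp [Fin.le_def])
      have h3 := mul_le_mul_of_nonneg_right h2 (hc ⟨m, hm'⟩)
      linarith
  rcases Nat.eq_zero_or_pos p with rfl | hp
  · simp
  · have hu : Iic (⟨p - 1, by omega⟩ : Fin p) = univ := by
      ext i; simp only [mem_Iic, mem_univ, Fin.le_def, iff_true]; omega
    have h1 := key (p - 1) (by omega)
    have h2 := hc ⟨p - 1, by omega⟩
    rw [hu] at h1 h2
    exact (mul_nonneg (hs0 _) h2).trans h1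

/-- A sum of decreasing weights with coefficients in `[0, 1]` of total mass at most `k + 1` is at
most the sum of the first `k + 1` weights. -/
theorem sum_mul_le_sum_Iic {p : ℕ} {w c : Fin p → ℝ} (hw : Antitone w) (hw0 : ∀ i, 0 ≤ w i)
    (hc0 : ∀ i, 0 ≤ c i) (hc1 : ∀ i, c i ≤ 1) (k : Fin p) (hc : ∑ i, c i ≤ k + 1) :
    ∑ i, w i * c i ≤ ∑ i ∈ Iic k, w i := by
  -- The weight `w k` serves as a threshold.
  have h1 : ∀ i, w i * c i ≤ w k * c i + if i ∈ Iic k then w i - w k else 0 := by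
    intro i
    split_ifs with hi
    · have := hw (mem_Iic.1 hi)
      nlinarith [hc1 i]
    · have := hw (not_le.1 (mem_Iic.not.1 hi)).le
      nlinarith [hc0 i]
  have h2 := sum_le_sum fun i (_ : i ∈ univ) => h1 i
  rw [sum_add_distrib, ← mul_sum, sum_ite_mem, univ_inter, sum_sub_distrib, sum_const,
    Fin.card_Iic, nsmul_eq_mul] at h2
  push_cast at h2
  nlinarith [hw0 k]

theorem decreasing_eq_self {p : ℕ} {x : Fin p → ℝ} (hx : Antitone x) : decreasing x = x := by
  have h := (Tuple.comp_sort_eq_comp_iff_monotone (f := x) (σ := Fin.revPerm)).2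
    fun i j hij => hx (Fin.rev_le_rev.2 hij)
  funext i
  have := congrFun h i.rev
  simpa [decreasing] using this.symm

/-- To bound a partial sum of `x↓` it suffices to bound the sum of `x` over every set of the same
number of coordinates. -/
theorem sum_decreasing_le {p : ℕ} {x : Fin p → ℝ} {k : Fin p} {B : ℝ}
    (h : ∀ I : Finset (Fin p), #I = k + 1 → ∑ i ∈ I, x i ≤ B) :
    ∑ i ∈ Iic k, decreasing x i ≤ B := by
  have h1 := h ((Iic k).map (Fin.revPerm.trans (Tuple.sort x)).toEmbedding) (by simp)
  rw [sum_map] at h1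
  simpa [decreasing] using h1

/-! ### Operators diagonal in an orthonormal basis -/

section operators

variable {p : ℕ} {V : Type*} [NormedAddCommGroup V] [InnerProductSpace ℂ V]

/-- The operator with real eigenvalues `c i` and eigenvectors `b i`. -/
noncomputable def diagOp (b : OrthonormalBasis (Fin p) ℂ V) (c : Fin p → ℝ) : V →ₗ[ℂ] V :=
  b.toBasis.constr ℂ fun i => (c i : ℂ) • b i

section diagOp

variable (b : OrthonormalBasis (Fin p) ℂ V) (c d : Fin p → ℝ)

@[simp]
theorem diagOp_apply_basis (i : Fin p) : diagOp b c (b i) = (c i : ℂ) • b i := by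
  rw [diagOp, ← b.coe_toBasis, b.toBasis.constr_basis]

theorem eq_diagOp_iff {T : V →ₗ[ℂ] V} : T = diagOp b c ↔ ∀ i, T (b i) = (c i : ℂ) • b i := by
  refine ⟨fun h i => by simp [h], fun h => b.toBasis.ext fun i => by simp [h]⟩

theorem diagOp_isSymmetric : (diagOp b c).IsSymmetric := by
  have h : ∀ i j, inner ℂ (diagOp b c (b i)) (b j) = inner ℂ (b i) (diagOp b c (b j)) := by
    intro i j
    rcases eq_or_ne i j with rfl | hij
    · simp
    · simp [b.inner_eq_zero hij]
  intro x y
  rw [← b.sum_repr x, ← b.sum_repr y]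
  simp only [map_sum, map_smul, sum_inner, inner_sum, inner_smul_left, inner_smul_right, h]

theorem inner_basis_diagOp (i : Fin p) (x : V) :
    inner ℂ (b i) (diagOp b c x) = c i * inner ℂ (b i) x := by
  rw [← diagOp_isSymmetric, diagOp_apply_basis, inner_smul_left, Complex.conj_ofReal]

theorem re_inner_diagOp (x : V) :
    (inner ℂ x (diagOp b c x)).re = ∑ i, c i * ‖inner ℂ (b i) x‖ ^ 2 := by
  rw [← b.sum_inner_mul_inner, Complex.re_sum]
  refine sum_congr rfl fun i _ => ?_
  rw [inner_basis_diagOp, ← inner_conj_symm x, mul_left_comm, Complex.conj_mul']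
  norm_cast

theorem diagOp_comp : diagOp b c ∘ₗ diagOp b d = diagOp b (c * d) := by
  rw [eq_diagOp_iff]; intro i; simp [smul_smul, mul_comm, -Complex.coe_smul]

theorem diagOp_one : diagOp b 1 = LinearMap.id := by
  symm; rw [eq_diagOp_iff]; intro i; simp

theorem trace_diagOp : LinearMap.trace ℂ V (diagOp b c) = ∑ i, (c i : ℂ) := by
  rw [LinearMap.trace_eq_sum_inner _ b]
  simp [inner_smul_right, -Complex.coe_smul]

end diagOp

/-- The spectral theorem with the eigenvalues in decreasing order. -/
theorem exists_diagOp [FiniteDimensional ℂ V] (hV : Module.finrank ℂ V = p) {T : V →ₗ[ℂ] V}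
    (hT : T.IsSymmetric) :
    ∃ (b : OrthonormalBasis (Fin p) ℂ V) (c : Fin p → ℝ), Antitone c ∧ T = diagOp b c :=
  ⟨hT.eigenvectorBasis hV, hT.eigenvalues hV, hT.eigenvalues_antitone hV,
    (eq_diagOp_iff _ _).2 fun i => hT.apply_eigenvectorBasis hV i⟩

/-! ### Weyl monotonicity and the Lidskii–Mirsky inequality -/

/-- Weyl's monotonicity principle. -/
theorem eigenvalue_le_of_quadratic_form_le {a b : OrthonormalBasis (Fin p) ℂ V}
    {α β : Fin p → ℝ} (hα : Antitone α) (hβ : Antitone β)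
    (h : ∀ x, (inner ℂ x (diagOp a α x)).re ≤ (inner ℂ x (diagOp b β x)).re) (i : Fin p) :
    α i ≤ β i := by
  have : FiniteDimensional ℂ V := a.toBasis.finiteDimensional_of_finite
  -- The `p - 1` conditions `⟪a j, x⟫ = 0` for `j > i` and `⟪b j, x⟫ = 0` for `j < i` have a common
  -- nonzero solution.
  let φ : V →ₗ[ℂ] ({j : Fin p // j ≠ i} → ℂ) :=
    LinearMap.pi fun j => if i < j.1 then (innerSL ℂ (a j.1)).toLinearMap
      else (innerSL ℂ (b j.1)).toLinearMap
  have hφ : LinearMap.ker φ ≠ ⊥ := by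
    apply LinearMap.ker_ne_bot_of_finrank_lt
    have hp : 0 < p := i.pos
    rw [Module.finrank_fintype_fun_eq_card, Module.finrank_eq_card_basis a.toBasis,
      Fintype.card_subtype_compl]
    simp
    omega
  obtain ⟨x, hx, hx0⟩ := (Submodule.ne_bot_iff _).1 hφ
  have hx' : ∀ j : Fin p, j ≠ i → (if i < j then inner ℂ (a j) x else inner ℂ (b j) x) = 0 := by
    intro j hj
    have := congrFun (LinearMap.mem_ker.1 hx) ⟨j, hj⟩
    simp only [φ, LinearMap.pi_apply, Pi.zero_apply] at this
    split_ifs at this ⊢ <;> simpa using this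
  have hpos : 0 < ‖x‖ ^ 2 := by positivity
  have h1 : α i * ‖x‖ ^ 2 ≤ (inner ℂ x (diagOp a α x)).re := by
    rw [re_inner_diagOp, ← a.sum_sq_norm_inner_right x, mul_sum]
    refine sum_le_sum fun j _ => ?_
    rcases le_or_gt j i with hj | hj
    · exact mul_le_mul_of_nonneg_right (hα hj) (by positivity)
    · have := hx' j hj.ne'
      rw [if_pos hj] at this
      simp [this]
  have h2 : (inner ℂ x (diagOp b β x)).re ≤ β i * ‖x‖ ^ 2 := by
    rw [re_inner_diagOp, ← b.sum_sq_norm_inner_right x, mul_sum]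
    refine sum_le_sum fun j _ => ?_
    rcases le_or_gt i j with hj | hj
    · exact mul_le_mul_of_nonneg_right (hβ hj) (by positivity)
    · have := hx' j hj.ne
      rw [if_neg hj.not_gt] at this
      simp [this]
  exact le_of_mul_le_mul_right ((h1.trans (h x)).trans h2) hpos

/-- If `A ≤ B + H + s` with `H = diagOp h γ ≥ 0`, the excess of the eigenvalues of `A` over those of
`B` is at most `s` up to nonnegative terms whose total is the trace of `H`. -/
theorem exists_eigenvalue_excess {a b h : OrthonormalBasis (Fin p) ℂ V}
    {α β γ : Fin p → ℝ} (hα : Antitone α) (hβ : Antitone β) (hγ : ∀ i, 0 ≤ γ i) {s : ℝ}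
    (hle : ∀ x, (inner ℂ x (diagOp a α x)).re ≤
      (inner ℂ x (diagOp b β x)).re + (inner ℂ x (diagOp h γ x)).re + s * ‖x‖ ^ 2) :
    ∃ δ : Fin p → ℝ, (∀ i, 0 ≤ δ i) ∧ (∀ i, α i - β i ≤ s + δ i) ∧ ∑ i, δ i = ∑ i, γ i := by
  have : FiniteDimensional ℂ V := a.toBasis.finiteDimensional_of_finite
  have hV : Module.finrank ℂ V = p := by simp [Module.finrank_eq_card_basis a.toBasis]
  obtain ⟨e, ε, hε, hT⟩ := exists_diagOp hV
    ((diagOp_isSymmetric b β).add (diagOp_isSymmetric h γ))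
  have hq : ∀ x, (inner ℂ x (diagOp e ε x)).re =
      (inner ℂ x (diagOp b β x)).re + (inner ℂ x (diagOp h γ x)).re := by
    intro x; rw [← hT, LinearMap.add_apply, inner_add_right, Complex.add_re]
  refine ⟨fun i => ε i - β i, fun i => sub_nonneg.2 ?_, fun i => ?_, ?_⟩
  · refine eigenvalue_le_of_quadratic_form_le (a := b) (b := e) hβ hε (fun x => ?_) i
    rw [hq, le_add_iff_nonneg_right, re_inner_diagOp]
    exact sum_nonneg fun j _ => mul_nonneg (hγ j) (by positivity)
  · have hs : Antitone fun j => ε j + s := fun _ _ hij => by simpa using hε hij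
    have := eigenvalue_le_of_quadratic_form_le (a := a) (b := e) hα hs (fun x => ?_) i
    · linarith
    · refine (hle x).trans_eq ?_
      rw [← hq, re_inner_diagOp, re_inner_diagOp, ← e.sum_sq_norm_inner_right x, mul_sum,
        ← sum_add_distrib]
      simp only [add_mul]
  · have := congrArg (fun T => (LinearMap.trace ℂ V T).re) hT
    simp only [map_add, trace_diagOp, Complex.add_re, Complex.re_sum, Complex.ofReal_re] at this
    rw [sum_sub_distrib]
    linarith

/-- The Lidskii–Mirsky inequality: eigenvalue differences of two Hermitian operators are weakly
majorized by the absolute eigenvalues of the difference of the operators. -/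
theorem sum_abs_sub_eigenvalues_le {a b h : OrthonormalBasis (Fin p) ℂ V}
    {α β η : Fin p → ℝ} (hα : Antitone α) (hβ : Antitone β) (hη : Antitone fun i => |η i|)
    (hH : diagOp a α - diagOp b β = diagOp h η) {k : Fin p} {I : Finset (Fin p)}
    (hI : #I = k + 1) :
    ∑ i ∈ I, |α i - β i| ≤ ∑ i ∈ Iic k, |η i| := by
  -- Let `A`, `B`, `H` be the operators with eigenvalues `α`, `β`, `η` and `s = |η k|`. Then
  -- `A - B ≤ s + (H - s)⁺` and `B - A ≤ s + (-H - s)⁺`, and the traces of the two positive parts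
  -- add up to the excess over `s` of the `k + 1` largest `|η i|`.
  set s := |η k| with hs
  have hq : ∀ x, (inner ℂ x (diagOp a α x)).re - (inner ℂ x (diagOp b β x)).re =
      ∑ i, η i * ‖inner ℂ (h i) x‖ ^ 2 := by
    intro x
    rw [← re_inner_diagOp, ← hH, LinearMap.sub_apply, inner_sub_right, Complex.sub_re]
  obtain ⟨δ, hδ0, hδ, hδs⟩ := exists_eigenvalue_excess (a := a) (b := b) (h := h)
    (γ := fun i => max (η i - s) 0) (s := s) hα hβ (fun i => le_max_right _ _) fun x => by
      rw [re_inner_diagOp h, ← h.sum_sq_norm_inner_right x, mul_sum, add_assoc, ← sum_add_distrib,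
        ← sub_le_iff_le_add', hq]
      refine sum_le_sum fun i _ => ?_
      rw [← add_mul]
      exact mul_le_mul_of_nonneg_right (by linarith [le_max_left (η i - s) 0]) (by positivity)
  obtain ⟨ε, hε0, hε, hεs⟩ := exists_eigenvalue_excess (a := b) (b := a) (h := h)
    (γ := fun i => max (-η i - s) 0) (s := s) hβ hα (fun i => le_max_right _ _) fun x => by
      rw [re_inner_diagOp h, ← h.sum_sq_norm_inner_right x, mul_sum, add_assoc, ← sum_add_distrib,
        ← sub_le_iff_le_add', ← neg_sub, hq, ← sum_neg_distrib]
      refine sum_le_sum fun i _ => ?_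
      rw [← add_mul, ← neg_mul]
      exact mul_le_mul_of_nonneg_right (by linarith [le_max_left (-η i - s) 0]) (by positivity)
  have h1 : ∑ i ∈ I, |α i - β i| ≤ ∑ i ∈ I, (s + (δ i + ε i)) :=
    sum_le_sum fun i _ => abs_le.2
      ⟨by linarith [hε i, hδ0 i], by linarith [hδ i, hε0 i]⟩
  have h2 : ∑ i ∈ I, (δ i + ε i) ≤ ∑ i, (δ i + ε i) :=
    sum_le_sum_of_subset_of_nonneg (subset_univ _) fun i _ _ => add_nonneg (hδ0 i) (hε0 i)
  have h3 : ∀ i, max (η i - s) 0 + max (-η i - s) 0 = if i ∈ Iic k then |η i| - s else 0 := by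
    intro i
    have hs0 : 0 ≤ s := abs_nonneg _
    split_ifs with hi
    · have : s ≤ |η i| := hη (mem_Iic.1 hi)
      rcases le_total 0 (η i) with h0 | h0
      · rw [abs_of_nonneg h0] at this ⊢
        rw [max_eq_left (by linarith), max_eq_right (by linarith)]; ring
      · rw [abs_of_nonpos h0] at this ⊢
        rw [max_eq_right (by linarith), max_eq_left (by linarith)]; ring
    · have : |η i| ≤ s := hη (not_le.1 (mem_Iic.not.1 hi)).le
      have := abs_le.1 this
      rw [max_eq_right (by linarith), max_eq_right (by linarith), add_zero]
  rw [sum_add_distrib, sum_const, hI, nsmul_eq_mul] at h1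
  rw [sum_add_distrib (s := univ), hδs, hεs, ← sum_add_distrib, sum_congr rfl fun i _ => h3 i,
    sum_ite_mem, univ_inter, sum_sub_distrib, sum_const, Fin.card_Iic, nsmul_eq_mul] at h2
  linarith

end operators

/-! ### Singular value decomposition -/

section SVD

variable {p : ℕ} {E F : Type*} [NormedAddCommGroup E] [InnerProductSpace ℂ E]
  [FiniteDimensional ℂ E] [NormedAddCommGroup F] [InnerProductSpace ℂ F] [FiniteDimensional ℂ F]

/-- The singular value decomposition of an operator between spaces of the same dimension. -/
theorem exists_singular_bases (hE : Module.finrank ℂ E = p) (hF : Module.finrank ℂ F = p)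
    (T : E →ₗ[ℂ] F) :
    ∃ (y : OrthonormalBasis (Fin p) ℂ E) (x : OrthonormalBasis (Fin p) ℂ F),
      ∀ i : Fin p, T (y i) = (T.singularValues i : ℂ) • x i := by
  let y := T.isSymmetric_adjoint_comp_self.eigenvectorBasis hE
  have hy : ∀ i : Fin p, LinearMap.adjoint T (T (y i)) = ((T.singularValues i : ℂ) ^ 2) • y i := by
    intro i
    have := T.isSymmetric_adjoint_comp_self.apply_eigenvectorBasis hE i
    rw [← T.sq_singularValues_fin hE i] at this
    rw [LinearMap.comp_apply] at this
    rw [this]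
    push_cast
    rfl
  have hin : ∀ i j : Fin p,
      inner ℂ (T (y i)) (T (y j)) = if i = j then ((T.singularValues i : ℂ) ^ 2) else 0 := by
    intro i j
    rw [← LinearMap.adjoint_inner_right, hy, inner_smul_right,
      orthonormal_iff_ite.1 y.orthonormal i j]
    split_ifs with h
    · simp [h]
    · simp
  -- The normalized images for nonzero singular values are orthonormal; the remaining vectors of `x`
  -- are an arbitrary completion, since there `T (y i) = 0`.
  let v : Fin p → F := fun i => ((T.singularValues i : ℂ)⁻¹) • T (y i)
  have hv : Orthonormal ℂ (({i : Fin p | T.singularValues i ≠ 0}).domRestrict v) := by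
    rw [orthonormal_iff_ite]
    rintro ⟨i, hi⟩ ⟨j, hj⟩
    have hi' : (T.singularValues i : ℂ) ≠ 0 := by exact_mod_cast hi
    simp only [Set.domRestrict_apply, v, inner_smul_left, inner_smul_right, hin, Subtype.mk.injEq]
    split_ifs with h
    · subst h
      simp only [map_inv₀, Complex.conj_ofReal]
      field_simp
    · simp
  obtain ⟨x, hx⟩ := hv.exists_orthonormalBasis_extension_of_card_eq (by simpa using hF)
  refine ⟨y, x, fun i => ?_⟩
  by_cases hi : T.singularValues i = 0
  · have := hin i i
    rw [if_pos rfl, hi] at this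
    simpa [hi] using this
  · have hi' : (T.singularValues i : ℂ) ≠ 0 := by exact_mod_cast hi
    rw [hx i hi, smul_smul, mul_inv_cancel₀ hi', one_smul]

end SVD

/-! ### Ky Fan estimates for weighted orthonormal families -/

section operators

variable {p : ℕ} {V : Type*} [NormedAddCommGroup V] [InnerProductSpace ℂ V]

theorem norm_sq_diagOp (e : OrthonormalBasis (Fin p) ℂ V) (t : Fin p → ℝ) (x : V) :
    ‖diagOp e t x‖ ^ 2 = ∑ i, t i ^ 2 * ‖inner ℂ (e i) x‖ ^ 2 := by
  rw [← e.sum_sq_norm_inner_right]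
  refine sum_congr rfl fun i _ => ?_
  rw [inner_basis_diagOp, norm_mul, mul_pow, Complex.norm_real, Real.norm_eq_abs, sq_abs]

/-- Ky Fan's inequality for the diagonal operator with weights `t i ^ 2`. -/
theorem sum_norm_sq_diagOp_le {e : OrthonormalBasis (Fin p) ℂ V} {t : Fin p → ℝ}
    (ht : Antitone fun i => t i ^ 2) {q : Fin p → V} (hq : Orthonormal ℂ q) (k : Fin p) :
    ∑ j ∈ Iic k, ‖diagOp e t (q j)‖ ^ 2 ≤ ∑ i ∈ Iic k, t i ^ 2 := by
  simp only [norm_sq_diagOp]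
  rw [sum_comm]
  simp only [← mul_sum]
  refine sum_mul_le_sum_Iic ht (fun i => sq_nonneg _) (fun i => by positivity) (fun i => ?_) k ?_
  · have := hq.sum_inner_products_le (e i) (s := Iic k)
    simpa [norm_inner_symm] using this
  · rw [sum_comm]
    simp [e.sum_sq_norm_inner_right, hq.norm_eq_one]

/-- Only the first `k + 1` of the weights `s` contribute to the bound, although the sum runs over
the whole basis `x`, because there are only `k + 1` vectors `q j`. -/
theorem sum_mul_sum_sq_inner_diagOp_le {e x : OrthonormalBasis (Fin p) ℂ V} {s t : Fin p → ℝ}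
    (hs : Antitone s) (hs0 : ∀ i, 0 ≤ s i) (ht : Antitone fun i => t i ^ 2) {q : Fin p → V}
    (hq : Orthonormal ℂ q) (k : Fin p) :
    ∑ i, s i * ∑ j ∈ Iic k, ‖inner ℂ (x i) (diagOp e t (q j))‖ ^ 2 ≤
      ∑ i ∈ Iic k, s i * t i ^ 2 := by
  have h : ∑ i ∈ Iic k, s i * t i ^ 2 = ∑ i, s i * if i ∈ Iic k then t i ^ 2 else 0 := by
    simp only [mul_ite, mul_zero, sum_ite_mem, univ_inter]
  rw [h]
  refine sum_mul_le_sum_mul_of_partial_sums hs hs0 fun l => ?_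
  rw [sum_ite_mem]
  -- The vectors `x i` and `q j` play symmetric roles; Bessel's inequality removes the larger
  -- family.
  rcases le_total l k with hlk | hkl
  · rw [inter_eq_left.2 (Iic_subset_Iic.2 hlk)]
    refine le_trans (sum_le_sum fun i _ => ?_)
      (sum_norm_sq_diagOp_le (e := e) ht x.orthonormal l)
    have := hq.sum_inner_products_le (diagOp e t (x i)) (s := Iic k)
    simpa only [← diagOp_isSymmetric e t _ _, norm_inner_symm _ (q _)] using this
  · rw [inter_eq_right.2 (Iic_subset_Iic.2 hkl), sum_comm]
    exact (sum_le_sum fun j _ => x.orthonormal.sum_inner_products_le _).trans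
      (sum_norm_sq_diagOp_le ht hq k)

/-- The numerical values of `B` at the vectors `diagOp e t (q j)`, with `q` orthonormal, are bounded
by the singular values of `B` weighted by the squares of the `t i`. -/
theorem sum_abs_re_inner_le [FiniteDimensional ℂ V] {e : OrthonormalBasis (Fin p) ℂ V}
    {t : Fin p → ℝ} (ht : Antitone fun i => t i ^ 2) {q : Fin p → V} (hq : Orthonormal ℂ q)
    (B : V →ₗ[ℂ] V) (k : Fin p) :
    ∑ j ∈ Iic k, |(inner ℂ (diagOp e t (q j)) (B (diagOp e t (q j)))).re| ≤
      ∑ i ∈ Iic k, B.singularValues i * t i ^ 2 := by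
  have hV : Module.finrank ℂ V = p := by simp [Module.finrank_eq_card_basis e.toBasis]
  obtain ⟨y, x, hB⟩ := exists_singular_bases hV hV B
  have hs0 := B.singularValues_nonneg
  have hs : Antitone fun i : Fin p => B.singularValues i := fun i j hij =>
    B.singularValues_antitone hij
  have h1 : ∀ g, |(inner ℂ g (B g)).re| ≤
      ∑ i : Fin p, B.singularValues i *
        ((‖inner ℂ (x i) g‖ ^ 2 + ‖inner ℂ (y i) g‖ ^ 2) / 2) := by
    intro g
    refine (Complex.abs_re_le_norm _).trans ?_
    conv_lhs => rw [← y.sum_repr g, map_sum, inner_sum, y.sum_repr g]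
    refine (norm_sum_le _ _).trans (sum_le_sum fun i _ => ?_)
    rw [map_smul, hB, inner_smul_right, inner_smul_right, norm_mul, norm_mul, Complex.norm_real,
      Real.norm_of_nonneg (hs0 _), y.repr_apply_apply, norm_inner_symm g, mul_left_comm]
    refine mul_le_mul_of_nonneg_left ?_ (hs0 _)
    nlinarith [sq_nonneg (‖inner ℂ (x i) g‖ - ‖inner ℂ (y i) g‖)]
  refine (sum_le_sum fun j _ => h1 _).trans ?_
  rw [sum_comm]
  have hx := sum_mul_sum_sq_inner_diagOp_le (e := e) (x := x) hs (fun i => hs0 i) ht hq k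
  have hy := sum_mul_sum_sq_inner_diagOp_le (e := e) (x := y) hs (fun i => hs0 i) ht hq k
  simp only [← mul_sum, ← sum_div, sum_add_distrib, mul_div_assoc', mul_add]
  linarith

/-! ### Eigenvalues on the diagonal after a similarity -/

/-- In the Gram–Schmidt basis obtained from eigenvectors of `K` the operator `K` is triangular, with
the eigenvalues on the diagonal. -/
theorem exists_orthonormal_inner_eq_eigenvalue {K : V →ₗ[ℂ] V} {g : Fin p → V} {η : Fin p → ℂ}
    (hg : LinearIndependent ℂ g) (hK : ∀ j, K (g j) = η j • g j) :
    ∃ q : Fin p → V, Orthonormal ℂ q ∧ ∀ j, inner ℂ (q j) (K (q j)) = η j := by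
  set q := InnerProductSpace.gramSchmidtNormed ℂ g with hqdef
  have hq : Orthonormal ℂ q := InnerProductSpace.gramSchmidtNormed_orthonormal hg
  refine ⟨q, hq, fun j => ?_⟩
  have h1 : q j ∈ Submodule.span ℂ (g '' Set.Iic j) := by
    rw [← InnerProductSpace.span_gramSchmidt_Iic, ← InnerProductSpace.span_gramSchmidtNormed]
    exact Submodule.subset_span ⟨j, Set.mem_Iic.2 le_rfl, rfl⟩
  have h2 : Submodule.span ℂ (g '' Set.Iic j) ≤
      (Submodule.span ℂ (q '' Set.Iio j)).comap (K - η j • LinearMap.id) := by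
    rw [hqdef, InnerProductSpace.span_gramSchmidtNormed, InnerProductSpace.span_gramSchmidt_Iio,
      Submodule.span_le]
    rintro _ ⟨i, hi, rfl⟩
    simp only [SetLike.mem_coe, Submodule.mem_comap, LinearMap.sub_apply, LinearMap.smul_apply,
      LinearMap.id_apply, hK, ← sub_smul]
    rcases (Set.mem_Iic.1 hi).eq_or_lt with rfl | hlt
    · simp
    · exact Submodule.smul_mem _ _ (Submodule.subset_span ⟨i, hlt, rfl⟩)
  have h3 : ∀ v ∈ Submodule.span ℂ (q '' Set.Iio j), inner ℂ (q j) v = 0 := by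
    intro v hv
    induction hv using Submodule.span_induction with
    | mem v hv =>
      obtain ⟨i, hi, rfl⟩ := hv
      exact hq.inner_eq_zero (ne_of_gt hi)
    | zero => simp
    | add u v _ _ hu hv => simp [hu, hv]
    | smul c v _ hv => simp [hv]
  -- `(K - η j) q j` lies in the span of the earlier vectors, to which `q j` is orthogonal.
  have h4 := h3 _ (h2 h1)
  simp only [LinearMap.sub_apply, LinearMap.smul_apply, LinearMap.id_apply, inner_sub_right,
    inner_smul_right, inner_self_eq_norm_sq_to_K, hq.norm_eq_one] at h4
  simpa [sub_eq_zero] using h4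

/-- The spectral theorem with the eigenvalues in decreasing order of absolute value. -/
theorem exists_diagOp_abs_antitone [FiniteDimensional ℂ V] (hV : Module.finrank ℂ V = p)
    {T : V →ₗ[ℂ] V} (hT : T.IsSymmetric) :
    ∃ (h : OrthonormalBasis (Fin p) ℂ V) (η : Fin p → ℝ),
      Antitone (fun i => |η i|) ∧ T = diagOp h η := by
  obtain ⟨b, c, -, rfl⟩ := exists_diagOp hV hT
  let π : Equiv.Perm (Fin p) := Fin.revPerm.trans (Tuple.sort fun i => |c i|)
  refine ⟨b.reindex π.symm, c ∘ π, decreasing_antitone fun i => |c i|, ?_⟩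
  rw [eq_diagOp_iff]
  intro i
  simp [-Complex.coe_smul]

/-- The identity behind the Corach–Porta–Recht inequality. With `T = diagOp e σ > 0`, the
eigenvalues `η` of `M - N` are those of `T^{-1/2} (M - N) T^{1/2}`, and for Hermitian `M`, `N` the
real part of the quadratic form of the latter is that of `T^{-1/2} (M T - T N) T^{-1/2}`. -/
theorem exists_orthonormal_re_inner_eq {M N : V →ₗ[ℂ] V} (hN : N.IsSymmetric)
    {e h : OrthonormalBasis (Fin p) ℂ V} {σ η : Fin p → ℝ} (hσ : ∀ i, 0 < σ i)
    (hη : M - N = diagOp h η) :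
    ∃ q : Fin p → V, Orthonormal ℂ q ∧ ∀ j,
      (inner ℂ (diagOp e (fun i => (√(σ i))⁻¹) (q j))
        ((M ∘ₗ diagOp e σ - diagOp e σ ∘ₗ N) (diagOp e (fun i => (√(σ i))⁻¹) (q j)))).re = η j := by
  set P := diagOp e fun i => √(σ i) with hP
  set R := diagOp e fun i => (√(σ i))⁻¹ with hR
  have hne : ∀ i, √(σ i) ≠ 0 := fun i => (Real.sqrt_pos.2 (hσ i)).ne'
  have hPR : ∀ v, P (R v) = v := fun v => by
    have : P ∘ₗ R = LinearMap.id := by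
      rw [hP, hR, diagOp_comp, ← diagOp_one e]
      congr 1; funext i; simp [hne i]
    exact LinearMap.congr_fun this v
  have hTR : ∀ v, diagOp e σ (R v) = P v := fun v => by
    have : diagOp e σ ∘ₗ R = P := by
      rw [hP, hR, diagOp_comp]
      congr 1; funext i
      simp only [Pi.mul_apply]
      rw [← div_eq_mul_inv, Real.div_sqrt]
    exact LinearMap.congr_fun this v
  have hRT : ∀ v, R (diagOp e σ v) = P v := fun v => by
    have : R ∘ₗ diagOp e σ = P := by
      rw [hP, hR, diagOp_comp]
      congr 1; funext i
      simp only [Pi.mul_apply]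
      rw [mul_comm, ← div_eq_mul_inv, Real.div_sqrt]
    exact LinearMap.congr_fun this v
  have hRinj : Function.Injective R := Function.LeftInverse.injective hPR
  have hPs : P.IsSymmetric := diagOp_isSymmetric _ _
  have hRs : R.IsSymmetric := diagOp_isSymmetric _ _
  have hg : LinearIndependent ℂ fun j => R (h j) :=
    h.orthonormal.linearIndependent.map' R (LinearMap.ker_eq_bot.2 hRinj)
  obtain ⟨q, hq, hqη⟩ := exists_orthonormal_inner_eq_eigenvalue (K := R ∘ₗ (M - N) ∘ₗ P)
    (η := fun j => (η j : ℂ)) hg fun j => by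
      simp [hη, hPR, -Complex.coe_smul]
  refine ⟨q, hq, fun j => ?_⟩
  have h1 := congrArg Complex.re (hqη j)
  simp only [LinearMap.comp_apply, LinearMap.sub_apply, map_sub, inner_sub_right,
    Complex.sub_re, Complex.ofReal_re] at h1 ⊢
  -- Passing to the adjoint replaces `R N P` by `P N R` without changing the real part.
  have h2 : (inner ℂ (R (q j)) (diagOp e σ (N (R (q j))))).re =
      (inner ℂ (q j) (R (N (P (q j))))).re := by
    rw [hRs, hRT, ← hPs, ← hN, ← hRs, ← inner_conj_symm, Complex.conj_re]
  rw [hTR, h2, hRs, h1]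

end operators

/-! ### Spectral variation from a Sylvester-type residual -/

/-- The weak majorization bound for the eigenvalues of Hermitian `M`, `N` in terms of the Sylvester
residual `M C - C N = B₁ - B₂*` with `C` invertible. -/
theorem sum_abs_sub_eigenvalues_le_of_sylvester {p : ℕ} {V : Type*} [NormedAddCommGroup V]
    [InnerProductSpace ℂ V] [FiniteDimensional ℂ V] {a b : OrthonormalBasis (Fin p) ℂ V}
    {α β : Fin p → ℝ} (hα : Antitone α) (hβ : Antitone β) {C B₁ B₂ : V →ₗ[ℂ] V}
    (hD : diagOp a α ∘ₗ C - C ∘ₗ diagOp b β = B₁ - LinearMap.adjoint B₂)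
    (hC : ∀ i : Fin p, 0 < C.singularValues i) {k : Fin p} {I : Finset (Fin p)}
    (hI : #I = k + 1) :
    ∑ i ∈ I, |α i - β i| ≤
      ∑ i ∈ Iic k, (B₁.singularValues i + B₂.singularValues i) / C.singularValues i.rev := by
  have hV : Module.finrank ℂ V = p := by simp [Module.finrank_eq_card_basis a.toBasis]
  obtain ⟨f, e₀, hf⟩ := exists_singular_bases hV hV C
  -- `C = T Ω` is the polar decomposition, with `Ω` unitary and `T = diagOp e σ` positive.
  let Ω : V ≃ₗᵢ[ℂ] V := f.equiv e₀ (Equiv.refl _)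
  let e := e₀.reindex Fin.revPerm
  let σ : Fin p → ℝ := fun i => C.singularValues i.rev
  have hT : ∀ v, C v = diagOp e σ (Ω v) := by
    have : C = diagOp e σ ∘ₗ Ω.toLinearEquiv.toLinearMap := f.toBasis.ext fun i => by
      have he : e₀ i = e i.rev := by simp [e]
      have hΩ : Ω (f i) = e₀ i := by simp [Ω]
      simp only [OrthonormalBasis.coe_toBasis, hf, LinearMap.comp_apply, LinearEquiv.coe_coe,
        LinearIsometryEquiv.coe_toLinearEquiv, hΩ]
      rw [he, diagOp_apply_basis, show σ i.rev = C.singularValues i by simp only [σ, Fin.rev_rev]]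
    exact fun v => LinearMap.congr_fun this v
  have hN : ∀ v, diagOp (b.map Ω) β v = Ω (diagOp b β (Ω.symm v)) := by
    have : Ω.toLinearEquiv.toLinearMap ∘ₗ diagOp b β ∘ₗ Ω.symm.toLinearEquiv.toLinearMap =
        diagOp (b.map Ω) β := by
      rw [eq_diagOp_iff]; intro i; simp [-Complex.coe_smul]
    exact fun v => (LinearMap.congr_fun this v).symm
  obtain ⟨h, η, hη, hH⟩ := exists_diagOp_abs_antitone hV
    ((diagOp_isSymmetric a α).sub (diagOp_isSymmetric (b.map Ω) β))
  obtain ⟨q, hq, hqη⟩ := exists_orthonormal_re_inner_eq (e := e) (σ := σ)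
    (diagOp_isSymmetric (b.map Ω) β) (fun i => hC i.rev) hH
  have ht2 : ∀ i, ((√(σ i))⁻¹) ^ 2 = (σ i)⁻¹ := fun i => by
    rw [inv_pow, Real.sq_sqrt (hC i.rev).le]
  have ht : Antitone fun i => ((√(σ i))⁻¹) ^ 2 := fun i j hij => by
    simp only [ht2]
    exact inv_anti₀ (hC i.rev) (C.singularValues_antitone (Fin.rev_le_rev.2 hij))
  have h₁ := sum_abs_re_inner_le ht hq (B₁ ∘ₗ Ω.symm.toLinearEquiv.toLinearMap) k (e := e)
  have h₂ := sum_abs_re_inner_le ht hq (Ω.toLinearEquiv.toLinearMap ∘ₗ B₂) k (e := e)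
  rw [singularValues_comp_isometry B₁ _ Ω (LinearIsometryEquiv.refl ℂ V) fun x => by simp] at h₁
  rw [singularValues_comp_isometry B₂ _ (LinearIsometryEquiv.refl ℂ V) Ω fun x => by simp] at h₂
  refine (sum_abs_sub_eigenvalues_le hα hβ hη hH hI).trans ?_
  simp only [ht2] at h₁ h₂
  have h₃ := add_le_add h₁ h₂
  simp only [← sum_add_distrib (s := Iic k), ← div_eq_mul_inv, ← add_div] at h₃
  refine le_trans ?_ h₃
  refine sum_le_sum fun j _ => ?_
  rw [← hqη j]
  set g := diagOp e (fun i => (√(σ i))⁻¹) (q j)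
  have hg : (diagOp a α ∘ₗ diagOp e σ - diagOp e σ ∘ₗ diagOp (b.map Ω) β) g =
      B₁ (Ω.symm g) - LinearMap.adjoint B₂ (Ω.symm g) := by
    rw [← LinearMap.sub_apply, ← hD]
    simp [hT, hN]
  have hg₂ : (inner ℂ g (LinearMap.adjoint B₂ (Ω.symm g))).re = (inner ℂ g (Ω (B₂ g))).re := by
    rw [LinearMap.adjoint_inner_right, ← Ω.inner_map_map, Ω.apply_symm_apply, ← inner_conj_symm,
      Complex.conj_re]
  rw [hg, inner_sub_right, Complex.sub_re, hg₂]
  exact abs_sub _ _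

/-! ### Matrices of orthonormal bases -/

theorem toEuclideanLin_eq_diagOp {p : ℕ} {M : Matrix (Fin p) (Fin p) ℂ} (hM : M.IsHermitian) :
    ∃ b, Matrix.toEuclideanLin M = diagOp b (eigenvalueVector hM) := by
  refine ⟨((Matrix.isSymmetric_toEuclideanLin_iff.mpr hM).eigenvectorBasis
    finrank_euclideanSpace).reindex (finCongr (Fintype.card_fin p)), ?_⟩
  rw [eq_diagOp_iff]
  intro i
  rw [OrthonormalBasis.reindex_apply]
  exact (Matrix.isSymmetric_toEuclideanLin_iff.mpr hM).apply_eigenvectorBasis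
    finrank_euclideanSpace _

theorem eigenvalueVector_antitone {p : ℕ} {M : Matrix (Fin p) (Fin p) ℂ} (hM : M.IsHermitian) :
    Antitone (eigenvalueVector hM) := fun _ _ hij => hM.eigenvalues₀_antitone hij

theorem singularValueVector_antitone {n p : ℕ} (M : Matrix (Fin n) (Fin p) ℂ) :
    Antitone (singularValueVector M) := fun _ _ hij =>
  (Matrix.toEuclideanLin M).singularValues_antitone hij

theorem singularValueVector_nonneg {n p : ℕ} (M : Matrix (Fin n) (Fin p) ℂ) (i : Fin p) :
    0 ≤ singularValueVector M i :=
  (Matrix.toEuclideanLin M).singularValues_nonneg i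

theorem singularValueVector_mul_of_conjTranspose_mul_eq_one {m n p : ℕ}
    {Y : Matrix (Fin n) (Fin m) ℂ} (hY : Y.conjTranspose * Y = 1) (Z : Matrix (Fin m) (Fin p) ℂ) :
    singularValueVector (Y * Z) = singularValueVector Z := by
  have h : LinearMap.adjoint (Matrix.toEuclideanLin (Y * Z)) ∘ₗ Matrix.toEuclideanLin (Y * Z) =
      LinearMap.adjoint (Matrix.toEuclideanLin Z) ∘ₗ Matrix.toEuclideanLin Z := by
    rw [← Matrix.toEuclideanLin_conjTranspose_eq_adjoint,
      ← Matrix.toEuclideanLin_conjTranspose_eq_adjoint, ← Matrix.toLpLin_mul, ← Matrix.toLpLin_mul,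
      Matrix.conjTranspose_mul, Matrix.mul_assoc, ← Matrix.mul_assoc _ Y Z, hY, Matrix.one_mul]
  have hp : Module.finrank ℂ (EuclideanSpace ℂ (Fin p)) = p := finrank_euclideanSpace_fin
  funext i
  rw [singularValueVector, singularValueVector, LinearMap.singularValues_fin _ hp,
    LinearMap.singularValues_fin _ hp]
  simp only [h]

section

variable {n p : ℕ} {X Y : Matrix (Fin n) (Fin p) ℂ} {𝒳 𝒴 : Submodule ℂ (EuclideanSpace ℂ (Fin n))}

theorem IsOrthonormalBasisMatrix.conjTranspose_mul_self (hX : IsOrthonormalBasisMatrix X 𝒳) :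
    X.conjTranspose * X = 1 := by
  ext i j
  have := orthonormal_iff_ite.1 hX.orthonormal i j
  rw [Matrix.one_apply, ← this]
  simp [PiLp.inner_apply, Matrix.mul_apply, mul_comm]

theorem IsOrthonormalBasisMatrix.projectorMatrix_eq (hX : IsOrthonormalBasisMatrix X 𝒳) :
    projectorMatrix 𝒳 = X * X.conjTranspose := by
  obtain ⟨b, hb⟩ := hX.exists_basis
  rw [projectorMatrix, LinearEquiv.symm_apply_eq]
  ext v i
  simp only [ContinuousLinearMap.coe_coe, b.starProjection_eq_sum_rankOne]
  simp [hb, PiLp.inner_apply, Matrix.toLpLin_apply, -Matrix.mulVec_mulVec,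
    Matrix.mulVec, dotProduct, mul_comm]

theorem IsOrthonormalBasisMatrix.singularValueVector_projectorMatrix_mul
    (hY : IsOrthonormalBasisMatrix Y 𝒴) {q : ℕ} (Z : Matrix (Fin n) (Fin q) ℂ) :
    singularValueVector (projectorMatrix 𝒴 * Z) = singularValueVector (Y.conjTranspose * Z) := by
  rw [hY.projectorMatrix_eq, Matrix.mul_assoc,
    singularValueVector_mul_of_conjTranspose_mul_eq_one hY.conjTranspose_mul_self]

theorem IsOrthonormalBasisMatrix.residualMatrix_eq_zero (hX : IsOrthonormalBasisMatrix X 𝒳)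
    {A : Matrix (Fin n) (Fin n) ℂ} (hA : ∀ v ∈ 𝒳, Matrix.toEuclideanLin A v ∈ 𝒳) :
    residualMatrix A X = 0 := by
  have h : projectorMatrix 𝒳 * (A * X) = A * X := by
    apply Matrix.toEuclideanLin.injective
    refine (EuclideanSpace.basisFun (Fin p) ℂ).toBasis.ext fun j => ?_
    have hj : Matrix.toEuclideanLin X (EuclideanSpace.basisFun (Fin p) ℂ j) ∈ 𝒳 := by
      rw [← hX.span_eq]
      exact Submodule.subset_span ⟨j, by simp [Matrix.toLpLin_apply]⟩
    rw [Matrix.toLpLin_mul (q := 2), Matrix.toLpLin_mul (q := 2), projectorMatrix]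
    simpa using Submodule.starProjection_eq_self_iff.2 (hA _ hj)
  rw [residualMatrix, Matrix.mul_assoc, ← Matrix.mul_assoc X, ← hX.projectorMatrix_eq, h, sub_self]

theorem singularValueVector_conjTranspose_mul_pos
    (hX : IsOrthonormalBasisMatrix X 𝒳) (hY : IsOrthonormalBasisMatrix Y 𝒴)
    (hΘ : ∀ i : Fin p, principalAngle 𝒳 𝒴 i < Real.pi / 2) (i : Fin p) :
    0 < singularValueVector (X.conjTranspose * Y) i := by
  have h := cos_principalAngle hX hY i.rev
  rw [Fin.rev_rev] at h
  rw [← h]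
  have h0 : 0 ≤ principalAngle 𝒳 𝒴 i.rev := Real.arccos_nonneg _
  exact Real.cos_pos_of_mem_Ioo ⟨by linarith [Real.pi_pos], hΘ _⟩

theorem one_le_cos_minAngle_div_cos_maxAngle
    (hX : IsOrthonormalBasisMatrix X 𝒳) (hY : IsOrthonormalBasisMatrix Y 𝒴)
    (hΘ : ∀ i : Fin p, principalAngle 𝒳 𝒴 i < Real.pi / 2) (hp : 0 < p) :
    1 ≤ Real.cos (minAngle 𝒳 𝒴) / Real.cos (maxAngle 𝒳 𝒴) := by
  have hnum : numAngles 𝒳 𝒴 - 1 = p - 1 := by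
    rw [numAngles, hX.finrank_eq, hY.finrank_eq, min_self]
  have hmin := cos_principalAngle hX hY ⟨p - 1, by omega⟩
  have hmax := cos_principalAngle hX hY ⟨0, hp⟩
  rw [minAngle, maxAngle, hnum, hmin, hmax,
    one_le_div (singularValueVector_conjTranspose_mul_pos hX hY hΘ _)]
  exact singularValueVector_antitone _ (Fin.rev_le_rev.2 (by simp [Fin.le_def]))

/-- The bound without the factor `√c`, over an arbitrary set of indices. -/
theorem sum_abs_sub_ritz_values_le {A : Matrix (Fin n) (Fin n) ℂ} (hA : A.IsHermitian)
    (hX : IsOrthonormalBasisMatrix X 𝒳) (hY : IsOrthonormalBasisMatrix Y 𝒴)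
    (hΘ : ∀ i : Fin p, principalAngle 𝒳 𝒴 i < Real.pi / 2) {k : Fin p} {I : Finset (Fin p)}
    (hI : #I = k + 1) :
    ∑ i ∈ I, |eigenvalueVector (Matrix.isHermitian_conjTranspose_mul_mul X hA) i -
        eigenvalueVector (Matrix.isHermitian_conjTranspose_mul_mul Y hA) i| ≤
      ∑ i ∈ Iic k, (singularValueVector (projectorMatrix 𝒴 * residualMatrix A X) i +
        singularValueVector (projectorMatrix 𝒳 * residualMatrix A Y) i) /
          Real.cos (principalAngle 𝒳 𝒴 i) := by
  simp only [cos_principalAngle hX hY, hX.singularValueVector_projectorMatrix_mul,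
    hY.singularValueVector_projectorMatrix_mul]
  obtain ⟨a, ha⟩ := toEuclideanLin_eq_diagOp (Matrix.isHermitian_conjTranspose_mul_mul X hA)
  obtain ⟨b, hb⟩ := toEuclideanLin_eq_diagOp (Matrix.isHermitian_conjTranspose_mul_mul Y hA)
  have hD : X.conjTranspose * A * X * (X.conjTranspose * Y) -
      X.conjTranspose * Y * (Y.conjTranspose * A * Y) =
      X.conjTranspose * residualMatrix A Y -
        (Y.conjTranspose * residualMatrix A X).conjTranspose := by
    simp only [residualMatrix, Matrix.mul_sub, Matrix.conjTranspose_sub, Matrix.conjTranspose_mul,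
      Matrix.conjTranspose_conjTranspose, hA.eq, Matrix.mul_assoc]
    abel
  have key := sum_abs_sub_eigenvalues_le_of_sylvester (a := a) (b := b)
    (C := Matrix.toEuclideanLin (X.conjTranspose * Y))
    (B₁ := Matrix.toEuclideanLin (X.conjTranspose * residualMatrix A Y))
    (B₂ := Matrix.toEuclideanLin (Y.conjTranspose * residualMatrix A X))
    (eigenvalueVector_antitone (Matrix.isHermitian_conjTranspose_mul_mul X hA))
    (eigenvalueVector_antitone (Matrix.isHermitian_conjTranspose_mul_mul Y hA))
    (by
      rw [← ha, ← hb, ← Matrix.toEuclideanLin_conjTranspose_eq_adjoint, ← Matrix.toLpLin_mul,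
        ← Matrix.toLpLin_mul, ← map_sub, ← map_sub, hD])
    (singularValueVector_conjTranspose_mul_pos hX hY hΘ) hI
  refine key.trans_eq (sum_congr rfl fun i _ => ?_)
  rw [add_comm]
  rfl

end

end RayleighRitz

open RayleighRitz
theorem mainTheorem2 {n p : ℕ} (A : Matrix (Fin n) (Fin n) ℂ) (hA : A.IsHermitian)
    (𝒳 𝒴 : Submodule ℂ (EuclideanSpace ℂ (Fin n))) (X Y : Matrix (Fin n) (Fin p) ℂ)
    (hX : IsOrthonormalBasisMatrix X 𝒳) (hY : IsOrthonormalBasisMatrix Y 𝒴)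
    (hΘ : ∀ i : Fin p, principalAngle 𝒳 𝒴 i < Real.pi / 2) :
    ((fun i => |eigenvalueVector (Matrix.isHermitian_conjTranspose_mul_mul X hA) i -
          eigenvalueVector (Matrix.isHermitian_conjTranspose_mul_mul Y hA) i|) ≺w
        fun i => Real.sqrt (Real.cos (minAngle 𝒳 𝒴) / Real.cos (maxAngle 𝒳 𝒴)) *
          ((singularValueVector (projectorMatrix 𝒴 * residualMatrix A X) i +
              singularValueVector (projectorMatrix 𝒳 * residualMatrix A Y) i) /
            Real.cos (principalAngle 𝒳 𝒴 i))) ∧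
    ((∀ v ∈ 𝒳, Matrix.toEuclideanLin A v ∈ 𝒳) →
      (fun i => |eigenvalueVector (Matrix.isHermitian_conjTranspose_mul_mul X hA) i -
          eigenvalueVector (Matrix.isHermitian_conjTranspose_mul_mul Y hA) i|) ≺w
        fun i => Real.sqrt (Real.cos (minAngle 𝒳 𝒴) / Real.cos (maxAngle 𝒳 𝒴)) *
          (singularValueVector (projectorMatrix 𝒳 * residualMatrix A Y) i /
            Real.cos (principalAngle 𝒳 𝒴 i))) := by
  refine and_iff_left_of_imp (fun h hinv => ?_) |>.2 ?_
  · have h0 : ∀ i : Fin p,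
        singularValueVector (projectorMatrix 𝒴 * residualMatrix A X) i = 0 := fun i => by
      rw [hX.residualMatrix_eq_zero hinv, Matrix.mul_zero, singularValueVector, map_zero,
        LinearMap.singularValues_zero, Finsupp.zero_apply]
    simpa only [h0, zero_add] using h
  intro k
  set r : Fin p → ℝ := fun i => singularValueVector (projectorMatrix 𝒴 * residualMatrix A X) i +
    singularValueVector (projectorMatrix 𝒳 * residualMatrix A Y) i with hr
  have hr0 : ∀ i, 0 ≤ r i := fun i =>
    add_nonneg (singularValueVector_nonneg _ i) (singularValueVector_nonneg _ i)
  have hra : Antitone r := (singularValueVector_antitone _).add (singularValueVector_antitone _)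
  have hpos : ∀ i : Fin p, 0 < Real.cos (principalAngle 𝒳 𝒴 i) := fun i => by
    rw [cos_principalAngle hX hY]
    exact singularValueVector_conjTranspose_mul_pos hX hY hΘ _
  have hmono : Antitone fun i : Fin p => r i / Real.cos (principalAngle 𝒳 𝒴 i) := by
    intro i j hij
    refine div_le_div₀ (hr0 i) (hra hij) (hpos i) ?_
    rw [cos_principalAngle hX hY, cos_principalAngle hX hY]
    exact singularValueVector_antitone _ (Fin.rev_le_rev.2 hij)
  have hc : 1 ≤ √(Real.cos (minAngle 𝒳 𝒴) / Real.cos (maxAngle 𝒳 𝒴)) :=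
    Real.one_le_sqrt.2 (one_le_cos_minAngle_div_cos_maxAngle hX hY hΘ k.pos)
  rw [decreasing_eq_self (hmono.const_mul (zero_le_one.trans hc))]
  refine sum_decreasing_le fun I hI => (sum_abs_sub_ritz_values_le hA hX hY hΘ hI).trans ?_
  exact Finset.sum_le_sum fun i _ =>
    le_mul_of_one_le_left (div_nonneg (hr0 i) (hpos i).le) hc
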